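/- Let $\mathscr{C}$ be a concept class over $\{0,1\}^n$, i.e. a set of functions $c:\{0,1\}^n\to\{0,1\}$. A set $S\subseteq\{0,1\}^n$ is shattered by $\mathscr{C}$ if every labeling $S\to\{0,1\}$ is the restriction to $S$ of some $c\in\mathscr{C}$, and the VC dimension of $\mathscr{C}$ is the size of a largest shattered set. For a probability distribution $D$ on $\{0,1\}^n$ and a concept $c$, the quantum example for $c$ under $D$ is the $(n+1)$-qubit state $$|\psi_{c,D}\rangle=\sum_{x\in\{0,1\}^n}\sqrt{D(x)}\,|x,c(x)\rangle .$$ A quantum learner using $T$ quantum examples is a POVM on the space of $T(n+1)$ qubits whose outcomes are labeled by the hypotheses $h:\{0,1\}^n\to\{0,1\}$ (not necessarily in $\mathscr{C}$), and $T$ is its sample complexity. It is an $(\varepsilon,\delta)$-PAC quantum learner for $\mathscr{C}$ if for every $c\in\mathscr{C}$ and every probability distribution $D$ on $\{0,1\}^n$, when applied to $|\psi_{c,D}\rangle^{\otimes T}$ it outputs, with probability at least $1-\delta$, a hypothesis $h$ with $\Pr_{x\sim D}[h(x)\neq c(x)]\leq\varepsilon$. **Theorem.** There are absolute constants $K>0$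 and $d_0\in\mathbb{N}$ such that for all integers $d\geq d_0$, all $n$, every concept class $\mathscr{C}$ over $\{0,1\}^n$ of VC dimension $d+1$, every $\delta\in(0,1/2)$ and every $\varepsilon\in(0,1/20)$: every $(\varepsilon,\delta)$-PAC quantum learner for $\mathscr{C}$ has sample complexity $$T\;\geq\;K\left(\frac{d}{\varepsilon}+\frac{1}{\varepsilon}\log_2\frac{1}{\delta}\right).$$ -/

import Mathlib

namespace QuantumPAC

open scoped ComplexOrder

/-- The domain `{0,1}^n`. -/
abbrev Cube (n : ℕ) : Type := Fin n → Bool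

/-- Concepts and hypotheses: Boolean functions on `{0,1}^n`. A concept class over `{0,1}^n` is a
`Finset (Concept n)`; since there are finitely many concepts, every set of concepts is of this
form. -/
abbrev Concept (n : ℕ) : Type := Cube n → Bool

/-- The VC dimension of a concept class: the largest cardinality of a set shattered by the family
of the sets `{x | c x = 1}`, for `c` in the class. -/
def vcDim {n : ℕ} (C : Finset (Concept n)) : ℕ :=
  (C.image fun c => Finset.univ.filter fun x => c x = true).vcDim

/-- `err_D(h, c) = Pr_{x ∼ D}[h x ≠ c x]`. -/
def err {n : ℕ} (D : Cube n → ℝ) (h c : Concept n) : ℝ :=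
  ∑ x with h x ≠ c x, D x

/-- Amplitudes, in the computational basis of `n + 1` qubits, of the quantum example
`∑ x, √(D x) |x, c x⟩`. -/
noncomputable def quantumExample {n : ℕ} (D : Cube n → ℝ) (c : Concept n) :
    Cube n × Bool → ℂ :=
  fun p => if p.2 = c p.1 then ((√(D p.1) : ℝ) : ℂ) else 0

/-- The tensor power `ψ^{⊗ T}`, in the product basis indexed by `Fin T → ι`. -/
def tensorPow {ι : Type*} (ψ : ι → ℂ) (T : ℕ) : (Fin T → ι) → ℂ :=
  fun z => ∏ i, ψ (z i)

/-- A quantum learner over `{0,1}^n` that uses `T` quantum examples: a POVM on the state space of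
`T` systems of `n + 1` qubits, whose outcomes are the hypotheses. The hypotheses need not belong
to any concept class. -/
structure QuantumLearner (n T : ℕ) where
  /-- The measurement operator of each hypothesis. -/
  povm : Concept n → Matrix (Fin T → Cube n × Bool) (Fin T → Cube n × Bool) ℂ
  posSemidef : ∀ h, (povm h).PosSemidef
  sum_eq_one : ∑ h, povm h = 1

/-- The probability `⟨Ψ| M_h |Ψ⟩` that the learner outputs `h`, where `Ψ` is the state of `T`
copies of the quantum example for `c` under `D`. -/
noncomputable def QuantumLearner.outputProb {n T : ℕ} (A : QuantumLearner n T)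
    (D : Cube n → ℝ) (c h : Concept n) : ℝ :=
  (star (tensorPow (quantumExample D c) T) ⬝ᵥ
    (A.povm h).mulVec (tensorPow (quantumExample D c) T)).re

/-- `A` is an `(ε, δ)`-PAC quantum learner for `C`: for every target concept `c ∈ C` and every
probability distribution `D` on `{0,1}^n`, it outputs some `h` with `err_D(h, c) ≤ ε` with
probability at least `1 - δ`. -/
def QuantumLearner.IsPAC {n T : ℕ} (A : QuantumLearner n T) (C : Finset (Concept n))
    (ε δ : ℝ) : Prop :=
  ∀ c ∈ C, ∀ D ∈ stdSimplex ℝ (Cube n),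
    1 - δ ≤ ∑ h with err D h c ≤ ε, A.outputProb D c h

end QuantumPAC

/-! A shattered set of size `d + 1` gives a point `s₀` always labelled 0 and `d` points `R` labelled
by an arbitrary `a ⊆ R`. Both bounds put most of the mass at `s₀`, so that examples are rarely
informative.

For `d / ε`, spread mass `20 * ε` over `R`. If `T` is small, each state is close to its truncation
to words with at most `m = d / 20` entries off `s₀`. The truncated amplitudes are polynomials of
degree at most `m` in the membership indicators of `a`, so these states span dimension at most `N =
#(lowSubsets R m)`. A hypothesis is acceptable for at most `N` sets `a`, hence by
`sum_success_le_mul_finrank` the success probabilities sum to at most `N ^ 2`, far too little for `2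
^ d` concepts.

For `log (1 / δ) / ε`, two concepts differing at a point of mass `2 * ε` have overlap at least `(1 -
2 * ε) ^ T`, while telling them apart forces overlap at most `2 * √δ`. -/

namespace QuantumPAC

open scoped ComplexOrder InnerProductSpace
open Finset

/-! ### Bounds for state identification and discrimination -/

section Measurement

variable {E F H : Type*} [NormedAddCommGroup E] [InnerProductSpace ℂ E]
  [NormedAddCommGroup F] [InnerProductSpace ℂ F]

/-- The squared norm of the image of a vector of norm at most one in a subspace is at most the
sum of the squared norms of the images of an orthonormal basis. -/
theorem norm_sq_map_le_sum_basis {V : Submodule ℂ E} {ι : Type*} [Fintype ι]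
    (b : OrthonormalBasis ι ℂ V) (L : E →ₗ[ℂ] F) {x : E} (hx : x ∈ V) (hx1 : ‖x‖ ≤ 1) :
    ‖L x‖ ^ 2 ≤ ∑ i, ‖L (b i)‖ ^ 2 := by
  have hsum : x = ∑ i, (b.repr ⟨x, hx⟩ i) • (b i : E) := by
    have := congrArg (Subtype.val) (b.sum_repr ⟨x, hx⟩)
    simpa using this.symm
  have hnorm : ∑ i, ‖b.repr ⟨x, hx⟩ i‖ ^ 2 ≤ 1 := by
    rw [← EuclideanSpace.norm_sq_eq, b.repr.norm_map]
    exact pow_le_one₀ (norm_nonneg _) hx1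
  have h1 : ‖L x‖ ≤ ∑ i, ‖b.repr ⟨x, hx⟩ i‖ * ‖L (b i)‖ := by
    conv_lhs => rw [hsum, map_sum]
    refine (norm_sum_le _ _).trans (le_of_eq ?_)
    simp [norm_smul]
  calc ‖L x‖ ^ 2 ≤ (∑ i, ‖b.repr ⟨x, hx⟩ i‖ * ‖L (b i)‖) ^ 2 := by gcongr
    _ ≤ (∑ i, ‖b.repr ⟨x, hx⟩ i‖ ^ 2) * ∑ i, ‖L (b i)‖ ^ 2 := sum_mul_sq_le_sq_mul_sq _ _ _
    _ ≤ 1 * ∑ i, ‖L (b i)‖ ^ 2 := by gcongr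
    _ = _ := one_mul _

/-- Dimension bound for state identification: if every outcome is acceptable for at most `N` of
the states `φ a`, all of them in a subspace `V`, then the success probabilities sum up to at most
`N * dim V`. -/
theorem sum_success_le_mul_finrank [Fintype H] {α : Type*} (L : H → E →ₗ[ℂ] F)
    (hL : ∀ x, ∑ h, ‖L h x‖ ^ 2 = ‖x‖ ^ 2) (V : Submodule ℂ E) [FiniteDimensional ℂ V]
    (P : Finset α) (φ : α → E) (hφ : ∀ a ∈ P, φ a ∈ V) (hφ1 : ∀ a ∈ P, ‖φ a‖ ≤ 1)
    (good : α → H → Prop) [∀ a h, Decidable (good a h)] (N : ℕ)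
    (hN : ∀ h, #{a ∈ P | good a h} ≤ N) :
    ∑ a ∈ P, ∑ h with good a h, ‖L h (φ a)‖ ^ 2 ≤ N * Module.finrank ℂ V := by
  let b := stdOrthonormalBasis ℂ V
  -- The trace over `V` bounds each term independently of `a`. Swapping sums leaves a count of good
  -- `a`, and completeness of the measurement turns the traces into `dim V`.
  calc ∑ a ∈ P, ∑ h with good a h, ‖L h (φ a)‖ ^ 2
      ≤ ∑ a ∈ P, ∑ h with good a h, ∑ i, ‖L h (b i)‖ ^ 2 :=
        sum_le_sum fun a ha => sum_le_sum fun h _ =>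
          norm_sq_map_le_sum_basis b (L h) (hφ a ha) (hφ1 a ha)
    _ = ∑ h, ∑ a ∈ P with good a h, ∑ i, ‖L h (b i)‖ ^ 2 := by
        simp only [sum_filter]
        exact sum_comm
    _ = ∑ h, (#{a ∈ P | good a h} : ℝ) * ∑ i, ‖L h (b i)‖ ^ 2 := by
        simp
    _ ≤ ∑ h, (N : ℝ) * ∑ i, ‖L h (b i)‖ ^ 2 := by
        refine sum_le_sum fun h _ => mul_le_mul_of_nonneg_right ?_ (by positivity)
        exact_mod_cast hN h
    _ = N * ∑ i, ∑ h, ‖L h (b i)‖ ^ 2 := by rw [← mul_sum, sum_comm]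
    _ = N * Module.finrank ℂ V := by
        simp only [hL]
        have : ∀ i, ‖(b i : E)‖ = 1 := b.norm_eq_one
        simp [this]

/-- If the outcome lies in `p` with probability at least `1 - δ` for the state `x`, and outside
`p` with probability at least `1 - δ` for the state `y`, then the overlap of `x` and `y` is at
most `2 * √δ`. -/
theorem norm_inner_le_two_mul_sqrt [Fintype H] (L : H → E →ₗ[ℂ] F)
    (hL : ∀ x y, ∑ h, ⟪L h x, L h y⟫_ℂ = ⟪x, y⟫_ℂ) {x y : E} (hx : ‖x‖ = 1) (hy : ‖y‖ = 1)
    (p : H → Prop) [DecidablePred p] {δ : ℝ}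
    (h1 : 1 - δ ≤ ∑ h with p h, ‖L h x‖ ^ 2) (h2 : 1 - δ ≤ ∑ h with ¬ p h, ‖L h y‖ ^ 2) :
    ‖⟪x, y⟫_ℂ‖ ≤ 2 * √δ := by
  have hL' : ∀ z, ∑ h, ‖L h z‖ ^ 2 = ‖z‖ ^ 2 := fun z => by
    have := hL z z
    simp only [inner_self_eq_norm_sq_to_K] at this
    exact_mod_cast this
  have split : ∀ z, ∑ h with p h, ‖L h z‖ ^ 2 + ∑ h with ¬ p h, ‖L h z‖ ^ 2 = ‖z‖ ^ 2 :=
    fun z => by rw [sum_filter_add_sum_filter_not, hL']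
  have cs : ∀ s : Finset H, ‖∑ h ∈ s, ⟪L h x, L h y⟫_ℂ‖ ≤
      √(∑ h ∈ s, ‖L h x‖ ^ 2) * √(∑ h ∈ s, ‖L h y‖ ^ 2) := fun s =>
    (norm_sum_le _ _).trans <| (sum_le_sum fun h _ => norm_inner_le_norm _ _).trans <|
      Real.sum_mul_le_sqrt_mul_sqrt _ _ _
  have sx := split x
  have sy := split y
  rw [hx] at sx
  rw [hy] at sy
  have px : 0 ≤ ∑ h with ¬ p h, ‖L h x‖ ^ 2 := by positivity
  have py : 0 ≤ ∑ h with p h, ‖L h y‖ ^ 2 := by positivity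
  -- On each half of the outcomes, one of the two Cauchy–Schwarz factors is at most `√δ`.
  rw [← hL, ← sum_filter_add_sum_filter_not univ p]
  refine (norm_add_le _ _).trans ?_
  have c1 := cs {h | p h}
  have c2 := cs {h | ¬ p h}
  have b1 : √(∑ h with p h, ‖L h x‖ ^ 2) * √(∑ h with p h, ‖L h y‖ ^ 2) ≤ 1 * √δ := by
    gcongr
    · exact Real.sqrt_le_one.2 (by linarith)
    · linarith
  have b2 : √(∑ h with ¬ p h, ‖L h x‖ ^ 2) * √(∑ h with ¬ p h, ‖L h y‖ ^ 2) ≤ √δ * 1 := by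
    gcongr
    · linarith
    · exact Real.sqrt_le_one.2 (by linarith)
  linarith

end Measurement

/-- The state `ψ^{⊗ T}` of `T` copies of the quantum example for `c` under `D`. -/
noncomputable def exampleState {n : ℕ} (T : ℕ) (D : Cube n → ℝ) (c : Concept n) :
    EuclideanSpace ℂ (Fin T → Cube n × Bool) :=
  WithLp.toLp 2 (tensorPow (quantumExample D c) T)

/-! ### From POVMs to measurement operators -/

section MatrixOrder

open scoped MatrixOrder
open Matrix

/-- Every positive semidefinite matrix is of the form `Bᴴ * B`. -/
theorem exists_conjTranspose_mul_self {ι : Type*} [Fintype ι] [DecidableEq ι]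
    {M : Matrix ι ι ℂ} (hM : M.PosSemidef) : ∃ B : Matrix ι ι ℂ, M = Bᴴ * B := by
  refine ⟨CFC.sqrt M, ?_⟩
  rw [(CFC.sqrt_nonneg M).posSemidef.1.eq]
  exact (CFC.sqrt_mul_sqrt_self M hM.nonneg).symm

/-- Measurement operators of a quantum learner. -/
theorem QuantumLearner.exists_measurement {n T : ℕ} (A : QuantumLearner n T) :
    ∃ L : Concept n → (EuclideanSpace ℂ (Fin T → Cube n × Bool) →ₗ[ℂ]
        EuclideanSpace ℂ (Fin T → Cube n × Bool)),
      (∀ x y, ∑ h, ⟪L h x, L h y⟫_ℂ = ⟪x, y⟫_ℂ) ∧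
      ∀ D c h, A.outputProb D c h = ‖L h (exampleState T D c)‖ ^ 2 := by
  choose B hB using fun h => exists_conjTranspose_mul_self (A.posSemidef h)
  have key : ∀ h (x y : EuclideanSpace ℂ (Fin T → Cube n × Bool)),
      ⟪Matrix.toEuclideanLin (B h) x, Matrix.toEuclideanLin (B h) y⟫_ℂ =
        star x.ofLp ⬝ᵥ (A.povm h).mulVec y.ofLp := fun h x y => by
    rw [hB, EuclideanSpace.inner_eq_star_dotProduct, dotProduct_comm]
    simp only [Matrix.ofLp_toLpLin, Matrix.toLin'_apply]
    rw [star_mulVec, ← dotProduct_mulVec, mulVec_mulVec]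
  refine ⟨fun h => Matrix.toEuclideanLin (B h), fun x y => ?_, fun D c h => ?_⟩
  · simp only [key]
    rw [← dotProduct_sum, ← sum_mulVec, A.sum_eq_one, one_mulVec,
      EuclideanSpace.inner_eq_star_dotProduct, dotProduct_comm]
  · have := key h (exampleState T D c) (exampleState T D c)
    rw [inner_self_eq_norm_sq_to_K] at this
    unfold QuantumLearner.outputProb
    simp only [exampleState] at this ⊢
    rw [← this]
    norm_cast

end MatrixOrder

/-! ### Counting small subsets; functions of low degree -/

section LowSubsets

variable {κ : Type*}

/-- The subsets of `R` of cardinality at most `m`. -/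
def lowSubsets (R : Finset κ) (m : ℕ) : Finset (Finset κ) := {S ∈ R.powerset | #S ≤ m}

theorem mem_lowSubsets {R S : Finset κ} {m : ℕ} : S ∈ lowSubsets R m ↔ S ⊆ R ∧ #S ≤ m := by
  simp [lowSubsets]

/-- Chernoff-type count: each small `S` has weight `x ^ #S ≥ x ^ m`, and all weights sum to `(x + 1)
^ #R`. -/
theorem card_lowSubsets_mul_pow_le (R : Finset κ) (m : ℕ) {x : ℝ} (h0 : 0 ≤ x) (h1 : x ≤ 1) :
    #(lowSubsets R m) * x ^ m ≤ (x + 1) ^ #R := by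
  rw [← sum_pow_mul_eq_add_pow, ← nsmul_eq_mul]
  simp only [one_pow, mul_one]
  calc #(lowSubsets R m) • x ^ m ≤ ∑ S ∈ lowSubsets R m, x ^ #S :=
        card_nsmul_le_sum _ _ _ fun S hS =>
          pow_le_pow_of_le_one h0 h1 (mem_lowSubsets.1 hS).2
    _ ≤ _ := sum_le_sum_of_subset_of_nonneg (filter_subset _ _) fun _ _ _ => by positivity

/-- The choice `x = 1 / 16` leaves the base `(17 / 16) ^ 2 * (4 / 3) = 289 / 192`, below `2 * (4 /
5)`; ten points suffice for the slack `(4 / 5) ^ #R` to absorb the factor 8. -/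
theorem eight_mul_card_lowSubsets_sq_le (R : Finset κ) {m : ℕ} (hm : 20 * m ≤ #R)
    (hR : 10 ≤ #R) : 8 * (#(lowSubsets R m) : ℝ) ^ 2 ≤ 2 ^ #R := by
  have h := card_lowSubsets_mul_pow_le R m (x := 1 / 16) (by norm_num) (by norm_num)
  have h2 : (#(lowSubsets R m) : ℝ) ≤ (17 / 16) ^ #R * 16 ^ m := by
    rw [one_div, inv_pow, ← div_eq_mul_inv, div_le_iff₀ (by positivity)] at h
    norm_num at h ⊢
    exact h
  have h3 : (256 : ℝ) ^ m ≤ (4 / 3) ^ #R := by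
    calc (256 : ℝ) ^ m ≤ ((4 / 3) ^ 20) ^ m := by gcongr; norm_num
      _ = (4 / 3) ^ (20 * m) := (pow_mul _ _ _).symm
      _ ≤ (4 / 3) ^ #R := by gcongr; norm_num
  have h4 : (4 / 5 : ℝ) ^ #R ≤ 1 / 8 :=
    (pow_le_pow_of_le_one (by norm_num) (by norm_num) hR).trans (by norm_num)
  calc 8 * (#(lowSubsets R m) : ℝ) ^ 2 ≤ 8 * ((17 / 16) ^ #R * 16 ^ m) ^ 2 := by gcongr
    _ = 8 * ((289 / 256) ^ #R * 256 ^ m) := by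
        rw [mul_pow, pow_right_comm, pow_right_comm (16 : ℝ)]
        norm_num
    _ ≤ 8 * ((289 / 256) ^ #R * (4 / 3) ^ #R) := by gcongr
    _ = 8 * (289 / 192) ^ #R := by rw [← mul_pow]; norm_num
    _ ≤ 8 * (2 * (4 / 5)) ^ #R := by gcongr; norm_num
    _ = 2 ^ #R * (8 * (4 / 5) ^ #R) := by rw [mul_pow]; ring
    _ ≤ 2 ^ #R * 1 := by gcongr; linarith
    _ = _ := mul_one _

variable [DecidableEq κ]

/-- The functions of a set `a` that are combinations of the indicators of `S ⊆ a`, where `S` is a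
subset of `R` of cardinality at most `m`. -/
def lowDegree (R : Finset κ) (m : ℕ) : Submodule ℂ (Finset κ → ℂ) :=
  Submodule.span ℂ (Set.range fun (S : lowSubsets R m) a => if S.1 ⊆ a then 1 else 0)

theorem indicator_mem_lowDegree {R S : Finset κ} {m : ℕ} (hS : S ⊆ R) (hm : #S ≤ m) :
    (fun a => if S ⊆ a then 1 else 0) ∈ lowDegree R m :=
  Submodule.subset_span ⟨⟨S, mem_lowSubsets.2 ⟨hS, hm⟩⟩, rfl⟩

theorem lowDegree_mono (R : Finset κ) {m m' : ℕ} (h : m ≤ m') : lowDegree R m ≤ lowDegree R m' := by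
  refine Submodule.span_le.2 ?_
  rintro _ ⟨⟨S, hS⟩, rfl⟩
  rw [mem_lowSubsets] at hS
  exact indicator_mem_lowDegree hS.1 (hS.2.trans h)

/-- Multiplying the monomial of `S` by the variable of `x` gives the monomial of `insert x S`. -/
theorem ite_mem_lowDegree {R : Finset κ} {m : ℕ} {f : Finset κ → ℂ} (hf : f ∈ lowDegree R m)
    {x : κ} (hx : x ∈ R) : (fun a => if x ∈ a then f a else 0) ∈ lowDegree R (m + 1) := by
  induction hf using Submodule.span_induction with
  | mem f hf =>
    obtain ⟨⟨S, hS⟩, rfl⟩ := hf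
    rw [mem_lowSubsets] at hS
    have := indicator_mem_lowDegree (R := R) (S := insert x S) (m := m + 1)
      (insert_subset hx hS.1) ((card_insert_le _ _).trans (by lia))
    simpa only [insert_subset_iff, ite_and] using this
  | zero =>
    simp only [Pi.zero_apply, ite_self]
    exact zero_mem (lowDegree R (m + 1))
  | add f g _ _ hf hg =>
    convert add_mem hf hg using 1
    ext a
    by_cases h : x ∈ a <;> simp [h]
  | smul r f _ hf =>
    convert Submodule.smul_mem _ r hf using 1
    ext a
    by_cases h : x ∈ a <;> simp [h]

/-- The indicator of prescribed membership in `a` of the entries of a word has degree at most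
the number of entries different from a point at which membership is fixed. -/
theorem prod_ite_mem_lowDegree {τ : Type*} [DecidableEq τ] {R : Finset κ} {s₀ : κ}
    (c : Finset κ → κ → Bool)
    (h0 : ∀ a, c a s₀ = false) (hc : ∀ a, ∀ x ∈ R, c a x = decide (x ∈ a)) (W : Finset τ)
    (z : τ → κ × Bool) (hz : ∀ i ∈ W, (z i).1 = s₀ ∨ (z i).1 ∈ R) :
    (fun a => ∏ i ∈ W, if (z i).2 = c a (z i).1 then (1 : ℂ) else 0) ∈
      lowDegree R #{i ∈ W | (z i).1 ≠ s₀} := by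
  induction W using Finset.induction_on with
  | empty => simpa using indicator_mem_lowDegree (R := R) (S := ∅) (m := 0) (by simp) (by simp)
  | insert i W hi ih =>
    have ih := ih fun j hj => hz j (mem_insert_of_mem hj)
    simp only [prod_insert hi]
    rcases eq_or_ne (z i).1 s₀ with h | h
    · rw [filter_insert, if_neg (by simpa using h)]
      simp only [h, h0]
      exact Submodule.smul_mem _ (if (z i).2 = false then 1 else 0) ih
    · have hR : (z i).1 ∈ R := (hz i (mem_insert_self _ _)).resolve_left h
      rw [filter_insert, if_pos h, card_insert_of_notMem (by simp [hi])]
      simp only [hc _ _ hR]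
      have h1 := ite_mem_lowDegree ih hR
      -- Label 0 contributes the factor "one minus the variable", label 1 the variable itself.
      cases hb : (z i).2
      · convert sub_mem (lowDegree_mono R (Nat.le_succ _) ih) h1 using 1
        ext a
        by_cases ha : (z i).1 ∈ a <;> simp [ha]
      · convert h1 using 1
        ext a
        by_cases ha : (z i).1 ∈ a <;> simp [ha]

/-- The number of sets `a ⊆ R` such that `c a` differs from `h` in at most `m` points of `R`. -/
theorem card_filter_disagreement_le {R : Finset κ} (c : Finset κ → κ → Bool)
    (hc : ∀ a, ∀ x ∈ R, c a x = decide (x ∈ a)) (h : κ → Bool) (m : ℕ) :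
    #{a ∈ R.powerset | #{x ∈ R | h x ≠ c a x} ≤ m} ≤ #(lowSubsets R m) := by
  -- With `h` fixed, the disagreement set determines `a`.
  refine card_le_card_of_injOn (fun a => {x ∈ R | h x ≠ c a x}) ?_ ?_
  · intro a ha
    exact mem_lowSubsets.2 ⟨filter_subset _ _, (mem_filter.1 ha).2⟩
  · intro a ha b hb hab
    simp only [coe_filter, mem_powerset, Set.mem_ofPred_eq] at ha hb
    ext x
    by_cases hx : x ∈ R
    · have := Finset.ext_iff.1 hab x
      simp only [mem_filter, hx, true_and, hc _ x hx] at this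
      by_cases h1 : x ∈ a <;> by_cases h2 : x ∈ b <;> cases h3 : h x <;> simp_all
    · exact iff_of_false (fun h' => hx (ha.1 h')) fun h' => hx (hb.1 h')

end LowSubsets

/-- If all coordinates of a family of vectors, as functions of the index, lie in the span of a
finite family `e`, then the family of vectors lies in a space of dimension at most the size
of `e`. -/
theorem exists_submodule_finrank_le {α ι κ : Type*} [Fintype ι] [Fintype κ]
    (φ : α → EuclideanSpace ℂ ι) (e : κ → α → ℂ)
    (h : ∀ z, (fun a => φ a z) ∈ Submodule.span ℂ (Set.range e)) :
    ∃ V : Submodule ℂ (EuclideanSpace ℂ ι),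
      Module.finrank ℂ V ≤ Fintype.card κ ∧ ∀ a, φ a ∈ V := by
  -- Row rank against column rank: the coefficients `g z s`, read as vectors in `z`, span the space,
  -- with `e s a` as the new coefficients.
  choose g hg using fun z => (Submodule.mem_span_range_iff_exists_fun ℂ).1 (h z)
  refine ⟨Submodule.span ℂ (Set.range fun s => WithLp.toLp 2 fun z => g z s),
    finrank_range_le_card _, fun a => (Submodule.mem_span_range_iff_exists_fun ℂ).2
      ⟨fun s => e s a, ?_⟩⟩
  ext z
  have := congrFun (hg z) a
  simp only [Finset.sum_apply, Pi.smul_apply, smul_eq_mul] at this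
  simp [← this, mul_comm]

/-! ### Independent trials -/

section Tensor

variable {κ : Type*} [Fintype κ]

theorem sum_prod_eq_pow {R : Type*} [CommSemiring R] (T : ℕ) (f : κ → R) :
    ∑ z : Fin T → κ, ∏ i, f (z i) = (∑ x, f x) ^ T := by
  rw [sum_pow', Fintype.piFinset_univ]

/-- Expected number of occurrences of an event in `T` independent trials. -/
theorem sum_prod_mul_card (T : ℕ) (f : κ → ℝ) (hf : ∑ x, f x = 1) (B : κ → Prop)
    [DecidablePred B] :
    ∑ z : Fin T → κ, (∏ i, f (z i)) * #{i | B (z i)} = T * ∑ x with B x, f x := by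
  have key : ∀ j : Fin T, ∑ z : Fin T → κ, (∏ i, f (z i)) * (if B (z j) then 1 else 0) =
      ∑ x with B x, f x := fun j => by
    -- Writing the event for trial `j` as a product over all `i` lets the sum over words factor.
    have h1 : ∀ z : Fin T → κ, (∏ i, f (z i)) * (if B (z j) then 1 else 0) =
        ∏ i, f (z i) * (if i = j then (if B (z i) then 1 else 0) else 1) := fun z => by
      rw [prod_mul_distrib, prod_ite_eq' univ j, if_pos (mem_univ _)]
    simp only [h1]
    have h2 := (prod_univ_sum (fun _ : Fin T => (univ : Finset κ)) fun i x =>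
      f x * (if i = j then (if B x then 1 else 0) else 1)).symm
    rw [Fintype.piFinset_univ] at h2
    rw [h2, prod_eq_single j]
    · simp [sum_filter]
    · intro i _ hi
      simp [hi, hf]
    · simp
  simp only [card_filter, Nat.cast_sum, mul_sum, Nat.cast_ite, Nat.cast_one, Nat.cast_zero]
  rw [sum_comm]
  simp only [key]
  rw [sum_const, card_univ, Fintype.card_fin, nsmul_eq_mul, mul_sum]

/-- Markov's inequality for the number of occurrences of an event in `T` independent trials. -/
theorem sum_prod_filter_le (T m : ℕ) (f : κ → ℝ) (h0 : ∀ x, 0 ≤ f x) (hf : ∑ x, f x = 1)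
    (B : κ → Prop) [DecidablePred B] :
    ∑ z : Fin T → κ with ¬ #{i | B (z i)} ≤ m, ∏ i, f (z i) ≤
      T * (∑ x with B x, f x) / (m + 1) := by
  rw [le_div_iff₀ (by positivity), ← sum_prod_mul_card T f hf, sum_mul]
  calc ∑ z : Fin T → κ with ¬ #{i | B (z i)} ≤ m, (∏ i, f (z i)) * ((m : ℝ) + 1)
      ≤ ∑ z : Fin T → κ with ¬ #{i | B (z i)} ≤ m, (∏ i, f (z i)) * #{i | B (z i)} := by
        refine sum_le_sum fun z hz => mul_le_mul_of_nonneg_left ?_ (prod_nonneg fun _ _ => h0 _)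
        have := (mem_filter.1 hz).2
        exact_mod_cast Nat.lt_of_not_le this
    _ ≤ _ := sum_le_sum_of_subset_of_nonneg (filter_subset _ _) fun _ _ _ =>
        mul_nonneg (prod_nonneg fun _ _ => h0 _) (by positivity)

end Tensor

/-! ### Overlaps and truncations of example states -/

section States

variable {n : ℕ}

theorem norm_sq_exampleState_apply (T : ℕ) {D : Cube n → ℝ} (hD : ∀ x, 0 ≤ D x) (c : Concept n)
    (z : Fin T → Cube n × Bool) :
    ‖exampleState T D c z‖ ^ 2 = ∏ i, if (z i).2 = c (z i).1 then D (z i).1 else 0 := by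
  simp only [exampleState, tensorPow, quantumExample, norm_prod, ← prod_pow]
  refine prod_congr rfl fun i _ => ?_
  split_ifs
  · rw [Complex.norm_real, Real.norm_eq_abs, sq_abs, Real.sq_sqrt (hD _)]
  · simp

theorem inner_exampleState (T : ℕ) {D : Cube n → ℝ} (hD : ∀ x, 0 ≤ D x) (c c' : Concept n) :
    ⟪exampleState T D c, exampleState T D c'⟫_ℂ = ((∑ x with c x = c' x, D x) ^ T : ℝ) := by
  rw [EuclideanSpace.inner_eq_star_dotProduct]
  simp only [exampleState, tensorPow, dotProduct, Pi.star_apply, star_prod, ← prod_mul_distrib]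
  rw [sum_prod_eq_pow T fun p => quantumExample D c' p * star (quantumExample D c p)]
  rw [Complex.ofReal_pow, Fintype.sum_prod_type, sum_filter, Complex.ofReal_sum]
  congr 1
  refine sum_congr rfl fun x _ => ?_
  have hsq : ((√(D x) : ℝ) : ℂ) * (√(D x) : ℝ) = D x := by
    rw [← Complex.ofReal_mul, Real.mul_self_sqrt (hD x)]
  cases h : c x <;> cases h' : c' x <;> simp [quantumExample, h, h', hsq]

theorem norm_exampleState (T : ℕ) {D : Cube n → ℝ} (hD : D ∈ stdSimplex ℝ (Cube n))
    (c : Concept n) : ‖exampleState T D c‖ = 1 := by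
  have h : ‖exampleState T D c‖ ^ 2 = 1 := by
    rw [← inner_self_eq_norm_sq (𝕜 := ℂ), inner_exampleState T hD.1 c c]
    simp [hD.2]
  exact (pow_eq_one_iff_of_nonneg (norm_nonneg _) two_ne_zero).1 h

/-- The part of `exampleState` on the words with at most `m` entries outside of `s₀`. -/
noncomputable def truncatedState (T : ℕ) (D : Cube n → ℝ) (s₀ : Cube n) (m : ℕ) (c : Concept n) :
    EuclideanSpace ℂ (Fin T → Cube n × Bool) :=
  WithLp.toLp 2 fun z => if #{i | (z i).1 ≠ s₀} ≤ m then exampleState T D c z else 0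

theorem norm_truncatedState_le (T : ℕ) {D : Cube n → ℝ} (hD : D ∈ stdSimplex ℝ (Cube n))
    (s₀ : Cube n) (m : ℕ) (c : Concept n) : ‖truncatedState T D s₀ m c‖ ≤ 1 := by
  rw [← norm_exampleState T hD c, EuclideanSpace.norm_eq, EuclideanSpace.norm_eq]
  refine Real.sqrt_le_sqrt (sum_le_sum fun z _ => ?_)
  simp only [truncatedState]
  split_ifs
  · rfl
  · simp

/-- The squared amplitudes are the law of `T` independent labelled examples, so this is Markov's
inequality for the number of draws that miss `s₀`. -/
theorem norm_sq_sub_truncatedState_le (T : ℕ) {D : Cube n → ℝ} (hD : D ∈ stdSimplex ℝ (Cube n))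
    (s₀ : Cube n) (m : ℕ) (c : Concept n) :
    ‖exampleState T D c - truncatedState T D s₀ m c‖ ^ 2 ≤ T * (1 - D s₀) / (m + 1) := by
  let f : Cube n × Bool → ℝ := fun p => if p.2 = c p.1 then D p.1 else 0
  have hf : ∑ p, f p = 1 := by
    rw [Fintype.sum_prod_type, ← hD.2]
    refine sum_congr rfl fun x _ => ?_
    cases h : c x <;> simp [f, h]
  have hB : ∑ p with p.1 ≠ s₀, f p = 1 - D s₀ := by
    have h1 : ∑ p with p.1 = s₀, f p = D s₀ := by
      rw [sum_filter, Fintype.sum_prod_type, sum_eq_single s₀]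
      · cases h : c s₀ <;> simp [f, h]
      · intro x _ hx
        simp [hx]
      · simp
    have h2 := sum_filter_add_sum_filter_not univ (fun p : Cube n × Bool => p.1 = s₀) f
    rw [h1, hf] at h2
    linarith
  have key := sum_prod_filter_le T m f (fun p => by
    simp only [f]; split_ifs; exacts [hD.1 _, le_rfl]) hf fun p => p.1 ≠ s₀
  rw [hB] at key
  refine le_trans (le_of_eq ?_) key
  rw [EuclideanSpace.norm_sq_eq, sum_filter]
  refine sum_congr rfl fun z _ => ?_
  by_cases h : #{i | (z i).1 ≠ s₀} ≤ m
  · simp [truncatedState, h]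
  · simp only [PiLp.sub_apply, truncatedState, h, if_false, sub_zero, not_false_eq_true, if_true]
    exact norm_sq_exampleState_apply T hD.1 c z

/-- The truncated states for concepts labelling `R` by the subsets of `R` span a space of
dimension at most the number of subsets of `R` of cardinality at most `m`. -/
theorem exists_submodule_truncatedState (T m : ℕ) {D : Cube n → ℝ} {s₀ : Cube n}
    {R : Finset (Cube n)} (hDR : ∀ x, D x ≠ 0 → x = s₀ ∨ x ∈ R)
    (c : Finset (Cube n) → Concept n) (h0 : ∀ a, c a s₀ = false)
    (hc : ∀ a, ∀ x ∈ R, c a x = decide (x ∈ a)) :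
    ∃ V : Submodule ℂ (EuclideanSpace ℂ (Fin T → Cube n × Bool)),
      Module.finrank ℂ V ≤ #(lowSubsets R m) ∧ ∀ a, truncatedState T D s₀ m (c a) ∈ V := by
  rw [← Fintype.card_coe]
  refine exists_submodule_finrank_le _ (fun (S : lowSubsets R m) a => if S.1 ⊆ a then 1 else 0)
    fun z => ?_
  change _ ∈ lowDegree R m
  by_cases hm : #{i | (z i).1 ≠ s₀} ≤ m
  swap
  · simp only [truncatedState, hm, if_false]
    exact zero_mem (lowDegree R m)
  have h : (fun a => truncatedState T D s₀ m (c a) z) =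
      (∏ i, ((√(D (z i).1) : ℝ) : ℂ)) •
        fun a => ∏ i, if (z i).2 = c a (z i).1 then (1 : ℂ) else 0 := by
    ext a
    simp only [truncatedState, hm, if_true, exampleState, tensorPow, quantumExample,
      Pi.smul_apply, smul_eq_mul, ← prod_mul_distrib, mul_ite, mul_one, mul_zero]
  rw [h]
  by_cases hz : ∀ i ∈ (univ : Finset (Fin T)), (z i).1 = s₀ ∨ (z i).1 ∈ R
  · exact Submodule.smul_mem _ _
      (lowDegree_mono R hm (prod_ite_mem_lowDegree c h0 hc univ z hz))
  · push Not at hz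
    obtain ⟨i, -, hi⟩ := hz
    have : D (z i).1 = 0 := by
      by_contra h
      exact (hDR _ h).elim hi.1 hi.2
    rw [prod_eq_zero (mem_univ i) (by simp [this]), zero_smul]
    exact zero_mem _

end States

/-! ### Shattered labels and the hard distribution -/

variable {n : ℕ}

/-- A class of VC dimension `d + 1` labels, for some point `s₀` and some set `R` of `d` further
points, `R` in all possible ways and `s₀` by `0`. -/
theorem exists_labelling {C : Finset (Concept n)} {d : ℕ} (hC : vcDim C = d + 1) :
    ∃ (s₀ : Cube n) (R : Finset (Cube n)) (c : Finset (Cube n) → Concept n),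
      s₀ ∉ R ∧ #R = d ∧ (∀ a, c a ∈ C) ∧ (∀ a, c a s₀ = false) ∧
        ∀ a, ∀ x ∈ R, c a x = decide (x ∈ a) := by
  let 𝒜 := C.image fun c => Finset.univ.filter fun x => c x = true
  have hne : 𝒜.shatterer.Nonempty := by
    rw [nonempty_iff_ne_empty]
    intro h
    have : 𝒜.vcDim = d + 1 := hC
    simp [Finset.vcDim, h] at this
  obtain ⟨s, hs, hcard⟩ := exists_mem_eq_sup _ hne card
  have hsd : #s = d + 1 := hcard.symm.trans hC
  obtain ⟨s₀, R, hs₀, hsR, hR⟩ := card_eq_succ.1 hsd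
  -- Intersecting with `R` forces the label 0 at `s₀` for every `a`.
  have key : ∀ a : Finset (Cube n), ∃ c ∈ C, ∀ x ∈ s, c x = decide (x ∈ a ∩ R) := by
    intro a
    have hsub : a ∩ R ⊆ s := inter_subset_right.trans (hsR ▸ subset_insert _ _)
    obtain ⟨u, hu, hua⟩ := (mem_shatterer.1 hs) hsub
    obtain ⟨c, hc, rfl⟩ := mem_image.1 hu
    refine ⟨c, hc, fun x hx => ?_⟩
    rw [← hua]
    simp [hx]
  choose c hcC hc using key
  refine ⟨s₀, R, c, hs₀, hR, hcC, fun a => ?_, fun a x hx => ?_⟩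
  · rw [hc a s₀ (hsR ▸ mem_insert_self _ _)]
    simp [hs₀]
  · rw [hc a x (hsR ▸ mem_insert_of_mem hx)]
    simp [hx]

/-- The distribution with mass `p` spread evenly over `R` and mass `1 - p` at `s₀`. -/
noncomputable def spikeDist (p : ℝ) (s₀ : Cube n) (R : Finset (Cube n)) : Cube n → ℝ :=
  fun x => if x = s₀ then 1 - p else if x ∈ R then p / #R else 0

section SpikeDist

variable {p : ℝ} {s₀ : Cube n} {R : Finset (Cube n)}

theorem spikeDist_of_mem (hs : s₀ ∉ R) {x : Cube n} (hx : x ∈ R) :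
    spikeDist p s₀ R x = p / #R := by
  have : x ≠ s₀ := fun h => hs (h ▸ hx)
  simp [spikeDist, hx, this]

theorem spikeDist_self : spikeDist p s₀ R s₀ = 1 - p := by
  simp [spikeDist]

theorem eq_or_mem_of_spikeDist_ne_zero {x : Cube n} (hx : spikeDist p s₀ R x ≠ 0) :
    x = s₀ ∨ x ∈ R := by
  by_contra! h
  simp [spikeDist, h] at hx

theorem spikeDist_mem_stdSimplex (hs : s₀ ∉ R) (hR : 0 < #R) (h0 : 0 ≤ p) (h1 : p ≤ 1) :
    spikeDist p s₀ R ∈ stdSimplex ℝ (Cube n) := by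
  refine ⟨fun x => ?_, ?_⟩
  · unfold spikeDist
    split_ifs
    · linarith
    · positivity
    · rfl
  · rw [← sum_subset (subset_univ (insert s₀ R)) fun x _ hx => by
      by_contra h
      exact hx (mem_insert.2 (eq_or_mem_of_spikeDist_ne_zero h)), sum_insert hs, spikeDist_self,
      sum_congr rfl fun x hx => spikeDist_of_mem hs hx]
    have : (#R : ℝ) ≠ 0 := by positivity
    simp only [sum_const, nsmul_eq_mul]
    field_simp
    ring

theorem card_mul_le_err (hs : s₀ ∉ R) (hR : 0 < #R) (h0 : 0 ≤ p) (h1 : p ≤ 1)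
    (h c : Concept n) :
    #{x ∈ R | h x ≠ c x} * (p / #R) ≤ err (spikeDist p s₀ R) h c := by
  rw [← nsmul_eq_mul, ← sum_const]
  calc ∑ x ∈ R with h x ≠ c x, p / #R = ∑ x ∈ R with h x ≠ c x, spikeDist p s₀ R x :=
        sum_congr rfl fun x hx => (spikeDist_of_mem hs (mem_filter.1 hx).1).symm
    _ ≤ _ := sum_le_sum_of_subset_of_nonneg (filter_subset_filter _ (subset_univ _))
        fun x _ _ => (spikeDist_mem_stdSimplex hs hR h0 h1).1 x

end SpikeDist

/-! ### The two lower bounds -/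

theorem norm_sq_map_le_two_mul_add {E F : Type*} [NormedAddCommGroup E] [InnerProductSpace ℂ E]
    [NormedAddCommGroup F] [InnerProductSpace ℂ F] (L : E →ₗ[ℂ] F) (x y : E) :
    ‖L x‖ ^ 2 ≤ 2 * ‖L y‖ ^ 2 + 2 * ‖L (x - y)‖ ^ 2 := by
  have h : ‖L x‖ ≤ ‖L y‖ + ‖L (x - y)‖ := by
    calc ‖L x‖ = ‖L y + L (x - y)‖ := by rw [map_sub, add_sub_cancel]
      _ ≤ _ := norm_add_le _ _
  calc ‖L x‖ ^ 2 ≤ (‖L y‖ + ‖L (x - y)‖) ^ 2 := by gcongr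
    _ ≤ _ := by nlinarith [sq_nonneg (‖L y‖ - ‖L (x - y)‖)]

/-- The part of the lower bound that depends on the VC dimension. -/
theorem QuantumLearner.IsPAC.dim_le {C : Finset (Concept n)} {d : ℕ} (hC : vcDim C = d + 1)
    (hd : 10 ≤ d) {ε δ : ℝ} (hε : 0 < ε) (hε' : ε < 1 / 20) (hδ : δ < 1 / 2) {T : ℕ}
    {A : QuantumLearner n T} (hA : A.IsPAC C ε δ) : (d : ℝ) / (3200 * ε) ≤ T := by
  obtain ⟨s₀, R, c, hs, hR, hcC, h0, hc⟩ := exists_labelling hC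
  have hR0 : 0 < #R := by lia
  have hd0 : (0 : ℝ) < d := by exact_mod_cast hR ▸ hR0
  obtain ⟨L, hLi, hL⟩ := A.exists_measurement
  have hLn : ∀ x, ∑ h, ‖L h x‖ ^ 2 = ‖x‖ ^ 2 := fun x => by
    have := hLi x x
    simp only [inner_self_eq_norm_sq_to_K] at this
    exact_mod_cast this
  set D := spikeDist (20 * ε) s₀ R with hDdef
  have hD : D ∈ stdSimplex ℝ (Cube n) :=
    spikeDist_mem_stdSimplex hs hR0 (by linarith) (by linarith)
  -- Each point of `R` has mass `20 * ε / d`, so error at most `ε` means at most `m` mistakes on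
  -- `R`; the same `m` serves as truncation degree.
  let m := d / 20
  let N : ℝ := #(lowSubsets R m)
  have hN : 8 * N ^ 2 ≤ 2 ^ d := by
    have := eight_mul_card_lowSubsets_sq_le R (m := m) (by lia) (by lia)
    rwa [hR] at this
  let ψ := fun a => exampleState T D (c a)
  let φ := fun a => truncatedState T D s₀ m (c a)
  let η : ℝ := 400 * ε * T / d
  have hη : ∀ a, ‖ψ a - φ a‖ ^ 2 ≤ η := fun a => by
    refine (norm_sq_sub_truncatedState_le T hD s₀ m (c a)).trans ?_
    rw [hDdef, spikeDist_self, div_le_div_iff₀ (by positivity) hd0]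
    have : (d : ℝ) ≤ 20 * (m + 1) := by
      have : d ≤ 20 * (m + 1) := by lia
      exact_mod_cast this
    nlinarith [mul_le_mul_of_nonneg_left this (by positivity : 0 ≤ ε * T)]
  obtain ⟨V, hV, hφV⟩ := exists_submodule_truncatedState T m (D := D) (s₀ := s₀) (R := R)
    (fun x hx => eq_or_mem_of_spikeDist_ne_zero hx) c h0 hc
  have hgood : ∀ h, #{a ∈ R.powerset | err D h (c a) ≤ ε} ≤ #(lowSubsets R m) := fun h => by
    refine le_trans (card_le_card ?_) (card_filter_disagreement_le c hc h m)
    refine monotone_filter_right _ fun a _ ha => ?_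
    have h1 := (card_mul_le_err hs hR0 (by linarith : 0 ≤ 20 * ε) (by linarith) h (c a)).trans ha
    rw [hR, mul_div_assoc', div_le_iff₀ hd0] at h1
    have h2 : (#{x ∈ R | h x ≠ c a x} : ℝ) * 20 ≤ d := by
      refine le_of_mul_le_mul_left ?_ hε
      linarith
    have h3 : #{x ∈ R | h x ≠ c a x} * 20 ≤ d := by exact_mod_cast h2
    change _ ≤ d / 20
    lia
  have hrank := sum_success_le_mul_finrank L hLn V R.powerset φ (fun a _ => hφV a)
    (fun a _ => norm_truncatedState_le T hD s₀ m (c a)) (fun a h => err D h (c a) ≤ ε) _ hgood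
  have hVr : (Module.finrank ℂ V : ℝ) ≤ N := Nat.cast_le.2 hV
  have hrank' : ∑ a ∈ R.powerset, ∑ h with err D h (c a) ≤ ε, ‖L h (φ a)‖ ^ 2 ≤ N ^ 2 := by
    refine hrank.trans ?_
    rw [sq]
    gcongr
  have hone : ∀ a, 1 - δ ≤ 2 * ∑ h with err D h (c a) ≤ ε, ‖L h (φ a)‖ ^ 2 + 2 * η := fun a => by
    calc 1 - δ ≤ ∑ h with err D h (c a) ≤ ε, ‖L h (ψ a)‖ ^ 2 := by
          simpa only [hL] using hA (c a) (hcC a) D hD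
      _ ≤ ∑ h with err D h (c a) ≤ ε, (2 * ‖L h (φ a)‖ ^ 2 + 2 * ‖L h (ψ a - φ a)‖ ^ 2) :=
          sum_le_sum fun h _ => norm_sq_map_le_two_mul_add _ _ _
      _ = 2 * ∑ h with err D h (c a) ≤ ε, ‖L h (φ a)‖ ^ 2 +
            2 * ∑ h with err D h (c a) ≤ ε, ‖L h (ψ a - φ a)‖ ^ 2 := by
          rw [sum_add_distrib, mul_sum, mul_sum]
      _ ≤ _ := by
          gcongr
          refine le_trans ?_ (hη a)
          rw [← hLn]
          exact sum_le_sum_of_subset_of_nonneg (filter_subset _ _) fun _ _ _ => by positivity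
  -- Averaged over `a`, the truncated success is at most `1 / 8`, so `1 / 2 < 1 - δ ≤ 1 / 4 + 2 *
  -- η`.
  have htot := sum_le_sum fun a (_ : a ∈ R.powerset) => hone a
  rw [sum_const, card_powerset, hR, nsmul_eq_mul, sum_add_distrib, ← mul_sum, sum_const,
    card_powerset, hR, nsmul_eq_mul] at htot
  push_cast at htot
  have hpow : (0 : ℝ) < 2 ^ d := by positivity
  have hfin : (1 : ℝ) / 8 ≤ η := by
    have h1 : (2 : ℝ) ^ d * (1 - δ) ≤ 2 ^ d * (1 / 4 + 2 * η) := by linarith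
    have := le_of_mul_le_mul_left h1 hpow
    linarith
  rw [div_le_div_iff₀ (by norm_num) hd0] at hfin
  rw [div_le_iff₀ (by positivity)]
  linarith

/-- The part of the lower bound that depends on the failure probability. -/
theorem QuantumLearner.IsPAC.log_le {C : Finset (Concept n)} {d : ℕ} (hC : vcDim C = d + 1)
    (hd : 0 < d) {ε δ : ℝ} (hε : 0 < ε) (hε' : ε < 1 / 20) (hδ : 0 < δ) (hδ' : δ < 1 / 16) {T : ℕ}
    {A : QuantumLearner n T} (hA : A.IsPAC C ε δ) : Real.log (1 / δ) / (16 * ε) ≤ T := by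
  obtain ⟨s₀, R, c, hs, hR, hcC, h0, hc⟩ := exists_labelling hC
  obtain ⟨x, hx⟩ := card_pos.1 (hR ▸ hd : 0 < #R)
  have hsx : s₀ ∉ ({x} : Finset (Cube n)) := by
    rw [mem_singleton]
    rintro rfl
    exact hs hx
  obtain ⟨L, hLi, hL⟩ := A.exists_measurement
  -- A mistake at `x` alone costs `2 * ε > ε`, so an acceptable hypothesis reveals the label of `x`.
  set D := spikeDist (2 * ε) s₀ {x} with hDdef
  have hD : D ∈ stdSimplex ℝ (Cube n) :=
    spikeDist_mem_stdSimplex hsx (by simp) (by linarith) (by linarith)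
  have hx0 : c ∅ x = false := by simp [hc _ x hx]
  have hx1 : c {x} x = true := by simp [hc _ x hx]
  have herr : ∀ h a, err D h (c a) ≤ ε → h x = c a x := fun h a hle => by
    by_contra hne
    have := (card_mul_le_err hsx (by simp) (by linarith : 0 ≤ 2 * ε) (by linarith) h
      (c a)).trans hle
    rw [filter_singleton, if_pos hne] at this
    simp at this
    linarith
  have hp : ∀ a (p : Concept n → Prop) [DecidablePred p], (∀ h, h x = c a x → p h) →
      1 - δ ≤ ∑ h with p h, ‖L h (exampleState T D (c a))‖ ^ 2 := fun a p _ hp => by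
    refine (hA (c a) (hcC a) D hD).trans ?_
    simp only [hL]
    exact sum_le_sum_of_subset_of_nonneg (monotone_filter_right _ fun h _ hh => hp h (herr h a hh))
      fun _ _ _ => by positivity
  have key := norm_inner_le_two_mul_sqrt L hLi (norm_exampleState T hD (c ∅))
    (norm_exampleState T hD (c {x})) (fun h => h x = false) (hp ∅ _ fun h hh => hh.trans hx0)
    (hp {x} _ fun h hh => by simp [hh, hx1])
  have hover : 1 - 2 * ε ≤ ∑ y with c ∅ y = c {x} y, D y := by
    calc 1 - 2 * ε = D s₀ := spikeDist_self.symm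
      _ ≤ _ := single_le_sum (f := D) (fun y _ => hD.1 y) (by simp [h0])
  rw [inner_exampleState T hD.1, Complex.norm_real, Real.norm_eq_abs] at key
  have hle : (1 - 2 * ε) ^ T ≤ 2 * √δ :=
    (pow_le_pow_left₀ (by linarith) hover T).trans ((le_abs_self _).trans key)
  have hlog := Real.log_le_log (pow_pos (by linarith) T) hle
  rw [Real.log_pow, Real.log_mul (by norm_num) (by positivity), Real.log_sqrt hδ.le] at hlog
  have hinv : 1 - (1 - 2 * ε)⁻¹ ≤ Real.log (1 - 2 * ε) :=
    Real.one_sub_inv_le_log_of_pos (by linarith)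
  have hinv' : -(4 * ε) ≤ 1 - (1 - 2 * ε)⁻¹ := by
    have : (1 - 2 * ε)⁻¹ ≤ 1 + 4 * ε := by
      rw [inv_le_iff_one_le_mul₀ (by linarith)]
      nlinarith
    linarith
  -- This absorbs the factor 2 of `2 * √δ`, leaving a quarter of `log δ`.
  have hδlog : Real.log δ ≤ -4 * Real.log 2 := by
    have := Real.log_le_log hδ hδ'.le
    rwa [show (1 / 16 : ℝ) = (2 ^ 4)⁻¹ by norm_num, Real.log_inv, Real.log_pow, Nat.cast_ofNat,
      ← neg_mul] at this
  have hT : (T : ℝ) * -(4 * ε) ≤ T * Real.log (1 - 2 * ε) :=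
    mul_le_mul_of_nonneg_left (hinv'.trans hinv) T.cast_nonneg
  rw [one_div, Real.log_inv, div_le_iff₀ (by positivity)]
  linarith

end QuantumPAC

theorem mainTheorem1 :
    ∃ K : ℝ, 0 < K ∧ ∃ d₀ : ℕ, ∀ d : ℕ, d₀ ≤ d →
      ∀ (n : ℕ) (C : Finset (QuantumPAC.Concept n)), QuantumPAC.vcDim C = d + 1 →
      ∀ ε δ : ℝ, 0 < ε → ε < 1 / 20 → 0 < δ → δ < 1 / 2 →
      ∀ (T : ℕ) (A : QuantumPAC.QuantumLearner n T), A.IsPAC C ε δ →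
        K * ((d : ℝ) / ε + 1 / ε * Real.logb 2 (1 / δ)) ≤ (T : ℝ) := by
  refine ⟨1 / 20000, by norm_num, 10, fun d hd n C hC ε δ hε hε' hδ hδ' T A hA => ?_⟩
  have hdim := hA.dim_le hC hd hε hε' hδ'
  have hd' : (10 : ℝ) ≤ d := by exact_mod_cast hd
  have hlog2 : 1 / 2 < Real.log 2 := by linarith [Real.log_two_gt_d9]
  rw [div_le_iff₀ (by positivity)] at hdim
  rw [one_div_mul_eq_div ε, ← add_div, one_div_mul_eq_div, div_div, div_le_iff₀ (by positivity)]
  rcases lt_or_ge δ (1 / 16) with h | h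
  · have hlog := hA.log_le hC (by lia) hε hε' hδ h
    rw [div_le_iff₀ (by positivity)] at hlog
    have hl0 : 0 ≤ Real.log (1 / δ) := Real.log_nonneg (by rw [le_div_iff₀ hδ]; linarith)
    have hb : Real.logb 2 (1 / δ) ≤ 2 * Real.log (1 / δ) := by
      rw [Real.logb, div_le_iff₀ (by linarith)]
      nlinarith
    have : 0 ≤ (T : ℝ) * ε := by positivity
    linarith
  -- For large `δ` the logarithm is bounded, and the dimension term absorbs it since `d ≥ 10`.
  · have hb : Real.logb 2 (1 / δ) ≤ 4 := by
      rw [Real.logb_le_iff_le_rpow (by norm_num) (by positivity), div_le_iff₀ hδ]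
      norm_num
      linarith
    linarith
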